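/- Let $\mathbb K$ be a field, let $G$ be a finite simple graph on $[n]=\{1,\dots,n\}$, and let $S=\mathbb K[x_1,\dots,x_n,y_1,\dots,y_n]$. Let $J_G\subseteq S$ be the binomial edge ideal of $G$, generated by the binomials $x_iy_j-x_jy_i$ for all edges $\{i,j\}$ of $G$ with $i<j$. Let $<$ be the lexicographic order on $S$ induced by $x_1>\cdots>x_n>y_1>\cdots>y_n$, and let $\Delta_<$ be the simplicial complex on the set of variables $\{x_1,\dots,x_n,y_1,\dots,y_n\}$ whose faces are the sets $F$ such that $\prod_{z\in F}z\notin \mathrm{in}_<(J_G)$ (simplicial complexes may contain the empty face). Suppose that $J_G$ is unmixed, that is, all associated primes of $S/J_G$ have the same height. Then the Stanley–Reisner ideal of $\Delta_<$ is $\mathrm{in}_<(J_G)$ (so $\Delta_<$ is the unique simplicial complex with this property). Moreover, let $$F=\{x_{i_1},\dots,x_{i_t},y_{j_1},\dots,y_{j_s}\}\in\Delta_<,\qquad 1\le j_1<\cdots<j_s<i_1<\cdots<i_t\le n,$$ where $t=0$ or $s=0$ is allowed, with $\dim F=|F|-1\le n-2$. Then the link $\mathrm{lk}_{\Delta_<}(F)=\{H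 : H\cap F=\emptyset,\ H\cup F\in\Delta_<\}$ is connected, i.e. for any two facets $A,B$ of the link there is a sequence of pairwise distinct facets $A=F_0,F_1,\dots,F_m=B$ ($m\ge 0$) of the link with $F_k\cap F_{k+1}\neq\emptyset$ for $0\le k<m$. -/

import Mathlib

open MvPolynomial

/-- A simplicial complex on a vertex set `V`: a family of finite subsets of `V` closed under
taking subsets. The empty set is allowed as a face, and not every vertex has to be a face. -/
@[ext]
structure SimpComplex (V : Type*) where
  faces : Set (Finset V)
  down_closed : ∀ F ∈ faces, ∀ F' ⊆ F, F' ∈ faces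

namespace SimpComplex

variable {V : Type*}

/-- The facets: the faces that are maximal with respect to inclusion. -/
def facets (Δ : SimpComplex V) : Set (Finset V) :=
  {F | Maximal (fun F' => F' ∈ Δ.faces) F}

/-- The link of `F` in `Δ`: all `H` disjoint from `F` with `H ∪ F` a face of `Δ`. -/
def link [DecidableEq V] (Δ : SimpComplex V) (F : Finset V) : SimpComplex V where
  faces := {H | Disjoint H F ∧ H ∪ F ∈ Δ.faces}
  down_closed := fun _ hH _ hsub =>
    ⟨hH.1.mono_left hsub, Δ.down_closed _ hH.2 _ (Finset.union_subset_union_left hsub)⟩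

/-- `Δ` is connected: any two facets are joined by a sequence `s 0, …, s m` of pairwise distinct
facets in which any two consecutive ones intersect. -/
def IsConnected [DecidableEq V] (Δ : SimpComplex V) : Prop :=
  ∀ F ∈ Δ.facets, ∀ H ∈ Δ.facets, ∃ (m : ℕ) (s : Fin (m + 1) → Finset V),
    s 0 = F ∧ s (Fin.last m) = H ∧ (∀ k, s k ∈ Δ.facets) ∧ Function.Injective s ∧
    ∀ k : Fin m, (s k.castSucc ∩ s k.succ).Nonempty

end SimpComplex

/-- The dimension `|F| - 1` of a face; the empty face has dimension `-1`. -/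
def faceDim {V : Type*} (F : Finset V) : ℤ := (F.card : ℤ) - 1

/-- The squarefree monomial `z_F`, the product of the variables in `F`. -/
noncomputable def sqfreeMonomial (K : Type*) [Field K] {V : Type*} (F : Finset V) :
    MvPolynomial V K := ∏ v ∈ F, X v

/-- The Stanley–Reisner ideal of `Δ` over `K`, generated by the `z_F` with `F` not a face. -/
noncomputable def stanleyReisnerIdeal (K : Type*) [Field K] {V : Type*} (Δ : SimpComplex V) :
    Ideal (MvPolynomial V K) :=
  Ideal.span {f | ∃ F : Finset V, F ∉ Δ.faces ∧ f = sqfreeMonomial K F}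

/-- The initial ideal of `I` with respect to the monomial order `m`, generated by the leading
monomials of the nonzero elements of `I`. -/
noncomputable def initialIdeal {K : Type*} [Field K] {V : Type*} (m : MonomialOrder V)
    (I : Ideal (MvPolynomial V K)) : Ideal (MvPolynomial V K) :=
  Ideal.span ((fun d => monomial d (1 : K)) '' (m.degree '' ((I : Set (MvPolynomial V K)) \ {0})))

/-- The complex of all `F` with `z_F` not in the initial ideal. By `eq_initialComplex` below, it is
the only complex whose Stanley–Reisner ideal can be the initial ideal of `I`. -/
noncomputable def initialComplex {K : Type*} [Field K] {V : Type*} (m : MonomialOrder V)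
    (I : Ideal (MvPolynomial V K)) : SimpComplex V where
  faces := {F | sqfreeMonomial K F ∉ initialIdeal m I}
  down_closed := fun _ hF _ hsub hmem =>
    hF (Ideal.mem_of_dvd _ (Finset.prod_dvd_prod_of_subset _ _ _ hsub) hmem)

theorem sqfreeMonomial_eq (K : Type*) [Field K] {V : Type*} (F : Finset V) :
    sqfreeMonomial K F = monomial (∑ v ∈ F, Finsupp.single v 1) (1 : K) := by
  simp [sqfreeMonomial, monomial_sum_one, X]

theorem sqfreeMonomial_mem_iff (K : Type*) [Field K] {V : Type*} (Δ : SimpComplex V)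
    (F : Finset V) : sqfreeMonomial K F ∈ stanleyReisnerIdeal K Δ ↔ F ∉ Δ.faces := by
  classical
  refine ⟨fun h hF => ?_, fun h => Ideal.subset_span ⟨F, h, rfl⟩⟩
  have hset : {f | ∃ F : Finset V, F ∉ Δ.faces ∧ f = sqfreeMonomial K F} =
      (fun s => monomial s (1 : K)) ''
        {d | ∃ F : Finset V, F ∉ Δ.faces ∧ d = ∑ v ∈ F, Finsupp.single v 1} := by
    ext f
    constructor
    · rintro ⟨F, hF, rfl⟩
      exact ⟨_, ⟨F, hF, rfl⟩, (sqfreeMonomial_eq K F).symm⟩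
    · rintro ⟨_, ⟨F, hF, rfl⟩, rfl⟩
      exact ⟨F, hF, (sqfreeMonomial_eq K F).symm⟩
  rw [stanleyReisnerIdeal, hset, mem_ideal_span_monomial_image, sqfreeMonomial_eq] at h
  obtain ⟨_, ⟨H, hH, rfl⟩, hle⟩ := h (∑ v ∈ F, Finsupp.single v 1) (by simp)
  refine hH (Δ.down_closed F hF H fun v hv => ?_)
  have h1 := hle v
  simp only [Finsupp.finsetSum_apply, Finsupp.single_apply, Finset.sum_ite_eq', hv, if_true] at h1
  by_contra hvF
  simp [hvF] at h1

theorem eq_initialComplex {K : Type*} [Field K] {V : Type*} (m : MonomialOrder V)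
    (I : Ideal (MvPolynomial V K)) (Δ : SimpComplex V)
    (h : stanleyReisnerIdeal K Δ = initialIdeal m I) : Δ = initialComplex m I := by
  ext F
  change F ∈ Δ.faces ↔ sqfreeMonomial K F ∉ initialIdeal m I
  rw [← h, sqfreeMonomial_mem_iff, not_not]

/-- An ideal is unmixed if all its associated primes have the same height. -/
def IsUnmixedIdeal {R : Type*} [CommRing R] (I : Ideal R) : Prop :=
  ∀ P ∈ associatedPrimes R (R ⧸ I), ∀ Q ∈ associatedPrimes R (R ⧸ I), P.height = Q.height

/-- The `2n` variables: two copies of the vertex set, the first for `x₁, …, xₙ` and the second for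
`y₁, …, yₙ`. In the order on this type, `x₁` comes first and `yₙ` last; since in the
lexicographic monomial order of Mathlib earlier variables are bigger,
`MonomialOrder.lex` is the order induced by `x₁ > ⋯ > xₙ > y₁ > ⋯ > yₙ`. -/
abbrev EdgeVar (n : ℕ) : Type := Fin n ⊕ₗ Fin n

/-- The variable `x_i`. -/
def xVar {n : ℕ} (i : Fin n) : EdgeVar n := Sum.inlₗ i

/-- The variable `y_j`. -/
def yVar {n : ℕ} (j : Fin n) : EdgeVar n := Sum.inrₗ j

/-- The binomial edge ideal of `G`, generated by `x_i y_j - x_j y_i` over the edges `{i, j}`,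
`i < j`. -/
noncomputable def binomialEdgeIdeal (K : Type*) [Field K] {n : ℕ} (G : SimpleGraph (Fin n)) :
    Ideal (MvPolynomial (EdgeVar n) K) :=
  Ideal.span {f | ∃ i j : Fin n, i < j ∧ G.Adj i j ∧
    f = X (xVar i) * X (yVar j) - X (xVar j) * X (yVar i)}

/-- The simplicial complex of the initial ideal of the binomial edge ideal of `G` with respect to
the lexicographic order induced by `x₁ > ⋯ > xₙ > y₁ > ⋯ > yₙ`. -/
noncomputable def edgeComplex (K : Type*) [Field K] {n : ℕ} (G : SimpleGraph (Fin n)) :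
    SimpComplex (EdgeVar n) :=
  initialComplex MonomialOrder.lex (binomialEdgeIdeal K G)

/-! Everything is reduced to combinatorics: `z_F` lies in the initial ideal exactly when `F` has a
crossing (`mem_edgeComplex_faces`). A crossing yields an element of the ideal by telescoping
binomials along a path (`prod_mul_edgeBinomial_mem`). Conversely, an exponent without crossing is
lex-minimal in its multidegree class, and a linear functional that sums the coefficients over that
class vanishes on the ideal, so such an exponent is never a leading one
(`hasCrossing_degree_support`).

A crossing depends only on the support, whence the initial ideal is squarefree. For the link, let
`b` be the largest index of a `y` in `F`. Adding `x_b` introduces no new index and no crossing, so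
`x_b` is adjacent to every `x`-vertex of the link; dually, `y_a` with `a` the smallest index of an
`x` in `F` is adjacent to every `y`-vertex. As `F` has fewer than `n` elements, some index is free,
and this provides an edge between an `x` and a `y` (`exists_xVar_yVar_mem_link`). -/

section Variables

variable {n : ℕ}

theorem xVar_injective : Function.Injective (xVar : Fin n → EdgeVar n) :=
  fun _ _ h => Sum.inl_injective (toLex.injective h)

theorem yVar_injective : Function.Injective (yVar : Fin n → EdgeVar n) :=
  fun _ _ h => Sum.inr_injective (toLex.injective h)

@[simp]
theorem xVar_inj {i j : Fin n} : xVar i = xVar j ↔ i = j := xVar_injective.eq_iff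

@[simp]
theorem yVar_inj {i j : Fin n} : yVar i = yVar j ↔ i = j := yVar_injective.eq_iff

@[simp]
theorem xVar_ne_yVar (i j : Fin n) : xVar i ≠ yVar j :=
  fun h => Sum.inl_ne_inr (toLex.injective h)

@[simp]
theorem yVar_ne_xVar (i j : Fin n) : yVar i ≠ xVar j := (xVar_ne_yVar j i).symm

theorem edgeVar_cases (z : EdgeVar n) : (∃ i, z = xVar i) ∨ ∃ i, z = yVar i := by
  rcases h : ofLex z with i | i
  · exact Or.inl ⟨i, congrArg toLex h⟩
  · exact Or.inr ⟨i, congrArg toLex h⟩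

theorem xVar_lt_xVar {i j : Fin n} : xVar i < xVar j ↔ i < j := Sum.Lex.inl_lt_inl_iff

theorem xVar_lt_yVar (i j : Fin n) : xVar i < yVar j := Sum.Lex.inl_lt_inr _ _

end Variables

/-! ### Crossings give monomials of the initial ideal. -/

section Reduction

variable {n : ℕ}

/-- The graph whose edges are the edges of `G` with both ends in `U`. -/
def edgesWithin (G : SimpleGraph (Fin n)) (U : Set (Fin n)) : SimpleGraph (Fin n) where
  Adj i j := G.Adj i j ∧ i ∈ U ∧ j ∈ U
  symm := ⟨fun _ _ h => ⟨h.1.symm, h.2.2, h.2.1⟩⟩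
  loopless := ⟨fun _ h => G.irrefl h.1⟩

theorem edgesWithin_le (G : SimpleGraph (Fin n)) (U : Set (Fin n)) : edgesWithin G U ≤ G :=
  fun _ _ h => h.1

theorem edgesWithin_mono (G : SimpleGraph (Fin n)) {U W : Set (Fin n)} (h : U ⊆ W) :
    edgesWithin G U ≤ edgesWithin G W :=
  fun _ _ hij => ⟨hij.1, h hij.2.1, h hij.2.2⟩

theorem mem_of_mem_support_edgesWithin {G : SimpleGraph (Fin n)} {U : Set (Fin n)} {i j k : Fin n}
    (p : (edgesWithin G U).Walk i j) (hi : i ∈ U) (hk : k ∈ p.support) : k ∈ U := by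
  induction p with
  | nil => simp_all
  | cons h p ih =>
    rcases List.mem_cons.1 (by simpa using hk) with rfl | hk
    · exact hi
    · exact ih h.2.2 hk

/-- The indices `i` for which `x_i` or `y_i` belongs to `F`. -/
def indexSet (F : Finset (EdgeVar n)) : Set (Fin n) := {i | xVar i ∈ F ∨ yVar i ∈ F}

theorem indexSet_mono {F H : Finset (EdgeVar n)} (h : F ⊆ H) : indexSet F ⊆ indexSet H :=
  fun _ hi => hi.imp (@h _) (@h _)

/-- There are `i < j` with `x_i, y_j ∈ F` joined by a path of `G` inside the index set of `F`. -/
def HasCrossing (G : SimpleGraph (Fin n)) (F : Finset (EdgeVar n)) : Prop :=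
  ∃ i j : Fin n, i < j ∧ xVar i ∈ F ∧ yVar j ∈ F ∧ (edgesWithin G (indexSet F)).Reachable i j

theorem HasCrossing.mono {G : SimpleGraph (Fin n)} {F H : Finset (EdgeVar n)}
    (h : HasCrossing G F) (hFH : F ⊆ H) : HasCrossing G H := by
  obtain ⟨i, j, hij, hi, hj, hr⟩ := h
  exact ⟨i, j, hij, hFH hi, hFH hj, hr.mono (edgesWithin_mono G (indexSet_mono hFH))⟩

variable (K : Type*) [Field K]

/-- The binomial `x_i y_j - x_j y_i`. -/
noncomputable def edgeBinomial (i j : Fin n) : MvPolynomial (EdgeVar n) K :=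
  X (xVar i) * X (yVar j) - X (xVar j) * X (yVar i)

theorem edgeBinomial_mem {G : SimpleGraph (Fin n)} {i j : Fin n} (h : G.Adj i j) :
    edgeBinomial K i j ∈ binomialEdgeIdeal K G := by
  rcases lt_or_gt_of_ne h.ne with hij | hij
  · exact Ideal.subset_span ⟨i, j, hij, h, rfl⟩
  · have h1 : edgeBinomial K i j = -edgeBinomial K j i := by simp only [edgeBinomial]; ring
    rw [h1]
    exact neg_mem (Ideal.subset_span ⟨j, i, hij, h.symm, rfl⟩)

/-- Induction along the path, writing `f_ij` for the binomial: `x_k f_ij = x_i f_kj + x_j f_ik`, and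
likewise with `y` in place of `x`. Hence either variable may be used at each interior vertex. -/
theorem prod_mul_edgeBinomial_mem {G H : SimpleGraph (Fin n)} (hHG : H ≤ G)
    (z : Fin n → EdgeVar n) (hz : ∀ k, z k = xVar k ∨ z k = yVar k) {i j : Fin n}
    (p : H.Walk i j) (hp : p.IsPath) (hij : i ≠ j) (T : Finset (Fin n))
    (hT : ∀ k ∈ p.support, k = i ∨ k = j ∨ k ∈ T) :
    (∏ k ∈ T, X (z k)) * edgeBinomial K i j ∈ binomialEdgeIdeal K G := by
  classical
  induction p generalizing T with
  | nil => exact absurd rfl hij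
  | @cons i k j h p ih =>
    rw [SimpleGraph.Walk.cons_isPath_iff] at hp
    have hik := edgeBinomial_mem K (hHG h)
    by_cases hkj : k = j
    · subst hkj
      exact Ideal.mul_mem_left _ _ hik
    have hkT : k ∈ T := by
      rcases hT k (by simp) with h1 | h1 | h1
      · exact absurd h1 h.ne'
      · exact absurd h1 hkj
      · exact h1
    have hrec := ih hp.1 hkj (T.erase k) (fun l hl => by
      by_cases hlk : l = k
      · exact Or.inl hlk
      rcases hT l (by simp [hl]) with h1 | h1 | h1
      · exact absurd (h1 ▸ hl) hp.2
      · exact Or.inr (Or.inl h1)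
      · exact Or.inr (Or.inr (Finset.mem_erase.2 ⟨hlk, h1⟩)))
    rw [← Finset.mul_prod_erase T _ hkT]
    set u : MvPolynomial (EdgeVar n) K := ∏ l ∈ T.erase k, X (z l)
    rcases hz k with hk | hk <;> rw [hk]
    · have h1 : X (xVar k) * u * edgeBinomial K i j =
          X (xVar i) * (u * edgeBinomial K k j) + X (xVar j) * u * edgeBinomial K i k := by
        simp only [edgeBinomial]; ring
      rw [h1]
      exact add_mem (Ideal.mul_mem_left _ _ hrec) (Ideal.mul_mem_left _ _ hik)
    · have h1 : X (yVar k) * u * edgeBinomial K i j =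
          X (yVar i) * (u * edgeBinomial K k j) + X (yVar j) * u * edgeBinomial K i k := by
        simp only [edgeBinomial]; ring
      rw [h1]
      exact add_mem (Ideal.mul_mem_left _ _ hrec) (Ideal.mul_mem_left _ _ hik)

theorem degree_edgeBinomial {i j : Fin n} (hij : i < j) :
    MonomialOrder.lex.degree (edgeBinomial K i j) =
      Finsupp.single (xVar i) 1 + Finsupp.single (yVar j) 1 := by
  classical
  have h1 : ∀ a b : Fin n, (X (xVar a) * X (yVar b) : MvPolynomial (EdgeVar n) K) =
      monomial (Finsupp.single (xVar a) 1 + Finsupp.single (yVar b) 1) 1 := fun a b => by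
    simp [X, monomial_mul]
  rw [edgeBinomial, sub_eq_add_neg, h1, h1, ← map_neg, MonomialOrder.degree_add_of_lt]
  · simp [MonomialOrder.degree_monomial]
  · simp only [MonomialOrder.degree_monomial, neg_eq_zero, one_ne_zero, if_false]
    rw [MonomialOrder.lex_lt_iff, Finsupp.Lex.lt_iff]
    refine ⟨xVar i, fun z hz => ?_, ?_⟩
    · obtain ⟨k, rfl⟩ | ⟨k, rfl⟩ := edgeVar_cases z
      · rw [xVar_lt_xVar] at hz
        simp [hz.ne', (hz.trans hij).ne']
      · exact absurd hz (xVar_lt_yVar i k).not_gt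
    · simp [hij.ne']

theorem sqfreeMonomial_mem_of_hasCrossing {G : SimpleGraph (Fin n)} {F : Finset (EdgeVar n)}
    (h : HasCrossing G F) :
    sqfreeMonomial K F ∈ initialIdeal MonomialOrder.lex (binomialEdgeIdeal K G) := by
  classical
  obtain ⟨i, j, hij, hi, hj, ⟨p⟩⟩ := h
  let z : Fin n → EdgeVar n := fun k => if xVar k ∈ F then xVar k else yVar k
  have hz : ∀ k, z k = xVar k ∨ z k = yVar k := fun k => by
    by_cases hk : xVar k ∈ F <;> simp [z, hk]
  have hzinj : Function.Injective z := fun k l hkl => by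
    rcases hz k with h1 | h1 <;> rcases hz l with h2 | h2 <;> simp_all
  -- Leaving out `i` and `j` makes the leading monomial squarefree, so that it divides `z_F`.
  let T : Finset (Fin n) := {k | k ∈ indexSet F ∧ k ≠ i ∧ k ≠ j}
  have hmem := prod_mul_edgeBinomial_mem K (edgesWithin_le G _) z hz p.toPath.1 p.toPath.2
    hij.ne T (fun k hk => by
      have := mem_of_mem_support_edgesWithin p.toPath.1 (Or.inl hi) hk
      simp only [T, Finset.mem_filter, Finset.mem_univ, true_and]
      tauto)
  have hzF : ∀ k ∈ T, z k ∈ F := fun k hk => by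
    have hk' : k ∈ indexSet F := by simp [T] at hk; exact hk.1
    by_cases h1 : xVar k ∈ F
    · simp [z, h1]
    · simpa [z, h1] using hk'.resolve_left h1
  have hbin : edgeBinomial K i j ≠ 0 := by
    refine MonomialOrder.lex.ne_zero_of_degree_ne_zero (fun h0 => ?_)
    rw [degree_edgeBinomial K hij] at h0
    simpa using DFunLike.congr_fun h0 (xVar i)
  have hprod : (∏ k ∈ T, X (z k) : MvPolynomial (EdgeVar n) K) =
      sqfreeMonomial K (T.image z) := by
    rw [sqfreeMonomial, Finset.prod_image hzinj.injOn]
  have hprod0 : (∏ k ∈ T, X (z k) : MvPolynomial (EdgeVar n) K) ≠ 0 :=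
    Finset.prod_ne_zero_iff.2 fun k _ => X_ne_zero _
  have hle : MonomialOrder.lex.degree ((∏ k ∈ T, X (z k)) * edgeBinomial K i j) =
      ∑ v ∈ insert (xVar i) (insert (yVar j) (T.image z)), Finsupp.single v 1 := by
    have hnot : ∀ k ∈ T, z k ≠ xVar i ∧ z k ≠ yVar j := fun k hk => by
      simp only [T, Finset.mem_filter] at hk
      rcases hz k with h1 | h1 <;> simp [h1, hk.2.2]
    rw [MonomialOrder.degree_mul hprod0 hbin, degree_edgeBinomial K hij, hprod,
      sqfreeMonomial_eq, MonomialOrder.degree_monomial, if_neg one_ne_zero,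
      Finset.sum_insert, Finset.sum_insert]
    · abel
    · simp only [Finset.mem_image, not_exists, not_and]
      exact fun k hk => (hnot k hk).2
    · simp only [Finset.mem_insert, Finset.mem_image, not_or, not_exists, not_and]
      exact ⟨xVar_ne_yVar _ _, fun k hk => (hnot k hk).1⟩
  have hin : sqfreeMonomial K (insert (xVar i) (insert (yVar j) (T.image z))) ∈
      initialIdeal MonomialOrder.lex (binomialEdgeIdeal K G) := by
    rw [sqfreeMonomial_eq, ← hle]
    exact Ideal.subset_span ⟨_, ⟨_, ⟨hmem, mul_ne_zero hprod0 hbin⟩, rfl⟩, rfl⟩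
  refine Ideal.mem_of_dvd _ (Finset.prod_dvd_prod_of_subset _ _ _ ?_) hin
  simp only [Finset.insert_subset_iff, Finset.image_subset_iff]
  exact ⟨hi, hj, hzF⟩

end Reduction

/-! ### Exponents without crossing are not leading exponents. -/

section Standard

variable {n : ℕ}

open scoped Classical in
/-- Two exponents have the same multidegree with respect to `H` if for each index the exponents of
`x_i` and `y_i` have the same sum, and for each connected component of `H` the total exponents of
the variables `x_k` in it agree. The exponents in a binomial `x_i y_j - x_j y_i` with `i`, `j` in
one component have the same multidegree. -/
def SameMultidegree (H : SimpleGraph (Fin n)) (m d : EdgeVar n →₀ ℕ) : Prop :=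
  (∀ i, m (xVar i) + m (yVar i) = d (xVar i) + d (yVar i)) ∧
  ∀ i, ∑ k with H.Reachable i k, m (xVar k) = ∑ k with H.Reachable i k, d (xVar k)

/-- Suppose `m` is smaller and first differs from `d` at `x_i`. Then `d` has no `y_k` with `k > i`
in the component of `i`, so its `x_k` exponents there are as large as possible and the component sum
of `d` is strictly larger. A first difference at `y_i` contradicts the sum at index `i`. -/
theorem SameMultidegree.toLex_le {H : SimpleGraph (Fin n)} {m d : EdgeVar n →₀ ℕ}
    (h : SameMultidegree H m d)
    (hd : ∀ i j, i < j → H.Reachable i j → d (xVar i) ≠ 0 → d (yVar j) = 0) :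
    toLex d ≤ toLex m := by
  classical
  by_contra! hlt
  obtain ⟨z, hz, hlt⟩ := Finsupp.Lex.lt_iff.1 hlt
  simp only [ofLex_toLex] at hz hlt
  obtain ⟨i, rfl⟩ | ⟨i, rfl⟩ := edgeVar_cases z
  · refine (Finset.sum_lt_sum (fun k hk => ?_) ⟨i, ?_, hlt⟩).ne (h.2 i)
    · rcases lt_trichotomy k i with hki | rfl | hik
      · exact (hz _ (xVar_lt_xVar.2 hki)).le
      · exact hlt.le
      · have h0 := hd i k hik (by simpa using hk) (by omega)
        have h1 := h.1 k
        omega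
    · simp
  · have h1 := h.1 i
    have h2 := hz _ (xVar_lt_yVar i i)
    omega

variable (K : Type*) [Field K]

/-- The sum of the coefficients at the exponents with property `P`. -/
noncomputable def coeffSum {V : Type*} (P : (V →₀ ℕ) → Prop) : MvPolynomial V K →ₗ[K] K :=
  open scoped Classical in
  (basisMonomials V K).constr K fun m => if P m then 1 else 0

open scoped Classical in
theorem coeffSum_monomial {V : Type*} (P : (V →₀ ℕ) → Prop) (m : V →₀ ℕ) (c : K) :
    coeffSum K P (monomial m c) = if P m then c else 0 := by
  have h1 : (monomial m c : MvPolynomial V K) = c • basisMonomials V K m := by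
    simp [smul_monomial]
  rw [h1, map_smul, coeffSum, Module.Basis.constr_basis]
  split_ifs <;> simp

theorem coeffSum_eq_zero {G : SimpleGraph (Fin n)} {U : Set (Fin n)} {d : EdgeVar n →₀ ℕ}
    (hd : ∀ i, i ∉ U → d (xVar i) + d (yVar i) = 0) {f : MvPolynomial (EdgeVar n) K}
    (hf : f ∈ binomialEdgeIdeal K G) :
    coeffSum K (fun m => SameMultidegree (edgesWithin G U) m d) f = 0 := by
  classical
  set P := fun m => SameMultidegree (edgesWithin G U) m d
  have key : ∀ (g : MvPolynomial (EdgeVar n) K) (i j : Fin n), i < j → G.Adj i j →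
      coeffSum K P (g * (X (xVar i) * X (yVar j) - X (xVar j) * X (yVar i))) = 0 := by
    intro g i j hij hadj
    induction g using MvPolynomial.induction_on' with
    | add p q hp hq => rw [add_mul, map_add, hp, hq, add_zero]
    | monomial m c =>
      have h1 : monomial m c * (X (xVar i) * X (yVar j) - X (xVar j) * X (yVar i)) =
          monomial (m + (Finsupp.single (xVar i) 1 + Finsupp.single (yVar j) 1)) c -
          monomial (m + (Finsupp.single (xVar j) 1 + Finsupp.single (yVar i) 1)) c := by
        simp [X, monomial_mul, mul_sub]
      rw [h1, map_sub, coeffSum_monomial, coeffSum_monomial, sub_eq_zero]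
      refine if_congr ?_ rfl rfl
      -- With both ends in `U` the two monomials have the same multidegree. Otherwise both involve
      -- an index at which `d` vanishes, so neither is counted.
      by_cases hU : i ∈ U ∧ j ∈ U
      · have hr : (edgesWithin G U).Adj i j := ⟨hadj, hU⟩
        refine and_congr (forall_congr' fun k => ?_) (forall_congr' fun k => ?_)
        · simp only [Finsupp.add_apply, Finsupp.single_apply, xVar_inj, yVar_inj, xVar_ne_yVar,
            yVar_ne_xVar, if_false]
          omega
        · have hkij : (edgesWithin G U).Reachable k i ↔ (edgesWithin G U).Reachable k j :=
            ⟨fun h => h.trans hr.reachable, fun h => h.trans hr.reachable.symm⟩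
          simp [Finset.sum_add_distrib, Finsupp.single_apply, hkij]
      · refine iff_of_false (fun h => ?_) (fun h => ?_) <;>
        · have hi := h.1 i
          have hj := h.1 j
          simp only [Finsupp.add_apply, Finsupp.single_apply, xVar_inj, yVar_inj, xVar_ne_yVar,
            yVar_ne_xVar, if_false, if_true] at hi hj
          by_cases hiU : i ∈ U
          · have := hd j fun hjU => hU ⟨hiU, hjU⟩
            omega
          · have := hd i hiU
            omega
  suffices h : ∀ g, coeffSum K P (g * f) = 0 by simpa using h 1
  induction hf using Submodule.span_induction with
  | mem f hf =>
    obtain ⟨i, j, hij, hadj, rfl⟩ := hf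
    exact fun g => key g i j hij hadj
  | zero => simp
  | add f g _ _ hf hg => exact fun a => by rw [mul_add, map_add, hf, hg, add_zero]
  | smul a f _ hf => exact fun g => by rw [smul_eq_mul, ← mul_assoc]; exact hf _

/-- If the leading exponent `d` had no crossing, it would be both the largest exponent of `f` and
the smallest in its class. The class sum of `f` would then be the leading coefficient, yet it is
zero. -/
theorem hasCrossing_degree_support {G : SimpleGraph (Fin n)} {f : MvPolynomial (EdgeVar n) K}
    (hf : f ∈ binomialEdgeIdeal K G) (hf0 : f ≠ 0) :
    HasCrossing G (MonomialOrder.lex.degree f).support := by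
  classical
  by_contra hcross
  set d := MonomialOrder.lex.degree f with hd
  have hstd : ∀ i j, i < j → (edgesWithin G (indexSet d.support)).Reachable i j →
      d (xVar i) ≠ 0 → d (yVar j) = 0 := fun i j hij hr hi => by
    by_contra hj
    exact hcross ⟨i, j, hij, by simpa using hi, by simpa using hj, hr⟩
  have hsum := coeffSum_eq_zero K (U := indexSet d.support) (d := d) (fun i hi => by
    simp only [indexSet, Set.mem_ofPred_eq, Finsupp.mem_support_iff] at hi
    omega) hf
  rw [f.as_sum, map_sum, Finset.sum_eq_single d] at hsum
  · rw [coeffSum_monomial, if_pos ⟨fun _ => rfl, fun _ => rfl⟩] at hsum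
    exact MonomialOrder.lex.coeff_degree_ne_zero_iff.2 hf0 hsum
  · intro m hm hmd
    rw [coeffSum_monomial, if_neg]
    intro hmd'
    have h1 : toLex d ≤ toLex m := hmd'.toLex_le hstd
    have h2 : toLex m ≤ toLex d := MonomialOrder.lex.le_degree hm
    exact hmd (toLex.injective (le_antisymm h2 h1))
  · intro hm
    exact absurd (MonomialOrder.lex.degree_mem_support hf0) hm

variable {K}

theorem mem_edgeComplex_faces {G : SimpleGraph (Fin n)} {F : Finset (EdgeVar n)} :
    F ∈ (edgeComplex K G).faces ↔ ¬ HasCrossing G F := by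
  classical
  refine ⟨fun hF h => hF (sqfreeMonomial_mem_of_hasCrossing K h), fun h hF => h ?_⟩
  rw [initialIdeal, mem_ideal_span_monomial_image, sqfreeMonomial_eq] at hF
  obtain ⟨_, ⟨f, ⟨hf, hf0⟩, rfl⟩, hle⟩ := hF (∑ v ∈ F, Finsupp.single v 1) (by simp)
  refine (hasCrossing_degree_support K hf hf0).mono fun v hv => ?_
  have h1 := hle v
  simp only [Finsupp.finsetSum_apply, Finsupp.single_apply, Finset.sum_ite_eq'] at h1
  by_contra hvF
  simp_all

variable (K)

theorem stanleyReisnerIdeal_edgeComplex (G : SimpleGraph (Fin n)) :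
    stanleyReisnerIdeal K (edgeComplex K G) =
      initialIdeal MonomialOrder.lex (binomialEdgeIdeal K G) := by
  refine le_antisymm (Ideal.span_le.2 ?_) (Ideal.span_le.2 ?_)
  · rintro _ ⟨F, hF, rfl⟩
    exact not_not.1 hF
  · rintro _ ⟨_, ⟨f, ⟨hf, hf0⟩, rfl⟩, rfl⟩
    -- The squarefree part of a leading monomial already lies in the Stanley–Reisner ideal, since
    -- its support has a crossing.
    refine Ideal.mem_of_dvd _ ?_ ((sqfreeMonomial_mem_iff K _ _).2 fun h =>
      mem_edgeComplex_faces.1 h (hasCrossing_degree_support K hf hf0))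
    rw [sqfreeMonomial_eq, monomial_dvd_monomial]
    refine ⟨Or.inr fun v => ?_, dvd_rfl⟩
    classical
    simp only [Finsupp.finsetSum_apply, Finsupp.single_apply, Finset.sum_ite_eq']
    split_ifs with hv
    · exact Nat.one_le_iff_ne_zero.2 (Finsupp.mem_support_iff.1 hv)
    · exact Nat.zero_le _

end Standard

/-! ### Connectedness read off from vertices and edges. -/

theorem SimpComplex.exists_facet_superset {V : Type*} [Finite V] (Δ : SimpComplex V)
    {F : Finset V} (hF : F ∈ Δ.faces) : ∃ H ∈ Δ.facets, F ⊆ H := by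
  obtain ⟨H, hFH, hH⟩ := (Set.toFinite Δ.faces).exists_le_maximal hF
  exact ⟨H, hH, hFH⟩

/-- A complex is connected if its vertices are connected by edges. -/
theorem SimpComplex.isConnected_of_vertices {V : Type*} [Finite V] [DecidableEq V]
    (Δ : SimpComplex V)
    (h : ∀ v w, {v} ∈ Δ.faces → {w} ∈ Δ.faces →
      Relation.ReflTransGen (fun a b => ({a, b} : Finset V) ∈ Δ.faces) v w) :
    Δ.IsConnected := by
  intro F hF H hH
  let Γ : SimpleGraph Δ.facets :=
    { Adj := fun A B => A ≠ B ∧ (A.1 ∩ B.1).Nonempty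
      symm := ⟨fun A B hAB => ⟨hAB.1.symm, by rw [Finset.inter_comm]; exact hAB.2⟩⟩
      loopless := ⟨fun A hA => hA.1 rfl⟩ }
  have hmeet : ∀ (A B : Δ.facets) (v : V), v ∈ A.1 → v ∈ B.1 → Γ.Reachable A B := by
    intro A B v hA hB
    by_cases hAB : A = B
    · rw [hAB]
    · exact SimpleGraph.Adj.reachable ⟨hAB, v, Finset.mem_inter.2 ⟨hA, hB⟩⟩
  have hchain : ∀ v w, Relation.ReflTransGen (fun a b => ({a, b} : Finset V) ∈ Δ.faces) v w →
      ∀ A B : Δ.facets, v ∈ A.1 → w ∈ B.1 → Γ.Reachable A B := by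
    intro v w hvw
    induction hvw with
    | refl => exact fun A B => hmeet A B v
    | @tail b c _ hbc ih =>
      intro A B hA hB
      obtain ⟨C, hC, hsub⟩ := Δ.exists_facet_superset hbc
      exact (ih A ⟨C, hC⟩ hA (hsub (by simp))).trans (hmeet ⟨C, hC⟩ B c (hsub (by simp)) hB)
  have hreach : Γ.Reachable ⟨F, hF⟩ ⟨H, hH⟩ := by
    -- An empty facet is the only facet.
    rcases F.eq_empty_or_nonempty with rfl | ⟨v, hv⟩
    · have h1 : H = ∅ := Finset.subset_empty.1 (hF.2 hH.1 (Finset.empty_subset H))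
      subst h1
      exact SimpleGraph.Reachable.refl _
    rcases H.eq_empty_or_nonempty with rfl | ⟨w, hw⟩
    · have h1 : F = ∅ := Finset.subset_empty.1 (hH.2 hF.1 (Finset.empty_subset F))
      subst h1
      exact SimpleGraph.Reachable.refl _
    · exact hchain v w (h v w (Δ.down_closed F hF.1 _ (by simpa using hv))
        (Δ.down_closed H hH.1 _ (by simpa using hw))) _ _ hv hw
  -- A path, rather than a walk, makes the facets pairwise distinct.
  obtain ⟨p, hp⟩ := hreach.exists_isPath
  refine ⟨p.length, fun k => (p.getVert k).1, by simp, by simp, fun k => (p.getVert k).2, ?_, ?_⟩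
  · intro k l hkl
    exact Fin.ext (hp.getVert_injOn (Nat.lt_succ_iff.1 k.2) (Nat.lt_succ_iff.1 l.2)
      (Subtype.ext hkl))
  · intro k
    exact (p.adj_getVert_succ k.2).2

/-! ### Connectedness of the link. -/

section Link

variable {n : ℕ} {G : SimpleGraph (Fin n)} {F : Finset (EdgeVar n)}

theorem not_hasCrossing_of_cut (G : SimpleGraph (Fin n)) (c : Fin n)
    (hx : ∀ i, xVar i ∈ F → c ≤ i) (hy : ∀ j, yVar j ∈ F → j ≤ c) : ¬ HasCrossing G F := by
  rintro ⟨i, j, hij, hi, hj, -⟩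
  exact absurd ((hy j hj).trans (hx i hi)) hij.not_ge

theorem exists_max_yVar (h : ∃ j, yVar j ∈ F) : ∃ b, yVar b ∈ F ∧ ∀ j, yVar j ∈ F → j ≤ b := by
  classical
  obtain ⟨j, hj⟩ := h
  obtain ⟨b, hb, hmax⟩ := Finset.exists_max_image {j : Fin n | yVar j ∈ F} id ⟨j, by simpa using hj⟩
  exact ⟨b, by simpa using hb, fun k hk => hmax k (by simpa using hk)⟩

theorem exists_min_xVar (h : ∃ i, xVar i ∈ F) : ∃ a, xVar a ∈ F ∧ ∀ i, xVar i ∈ F → a ≤ i := by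
  classical
  obtain ⟨i, hi⟩ := h
  obtain ⟨a, ha, hmin⟩ := Finset.exists_min_image {i : Fin n | xVar i ∈ F} id ⟨i, by simpa using hi⟩
  exact ⟨a, by simpa using ha, fun k hk => hmin k (by simpa using hk)⟩

theorem exists_index_notMem (hcard : F.card < n) : ∃ m : Fin n, xVar m ∉ F ∧ yVar m ∉ F := by
  classical
  let index : EdgeVar n → Fin n := fun z => Sum.elim id id (ofLex z)
  have hlt : (F.image index).card < (Finset.univ : Finset (Fin n)).card := by
    simpa using Finset.card_image_le.trans_lt hcard
  obtain ⟨m, -, hm⟩ := Finset.exists_mem_notMem_of_card_lt_card hlt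
  exact ⟨m, fun h => hm (Finset.mem_image.2 ⟨_, h, rfl⟩),
    fun h => hm (Finset.mem_image.2 ⟨_, h, rfl⟩)⟩

variable [DecidableEq (EdgeVar n)]

/-- Since `y_b` is in `F`, the index set does not grow; since no `y_j` in `F` has `j > b`, the new
`x_b` starts no crossing. -/
theorem not_hasCrossing_insert_xVar (hF : ∀ i j, xVar i ∈ F → yVar j ∈ F → j < i)
    {p b : Fin n} (hb : yVar b ∈ F) (hmax : ∀ j, yVar j ∈ F → j ≤ b)
    (hp : ¬ HasCrossing G ({xVar p} ∪ F)) : ¬ HasCrossing G ({xVar p, xVar b} ∪ F) := by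
  rintro ⟨i, j, hij, hi, hj, hr⟩
  replace hj : yVar j ∈ F := by simpa using hj
  simp only [Finset.mem_union, Finset.mem_insert, Finset.mem_singleton, xVar_inj] at hi
  rcases hi with (rfl | rfl) | hi
  · refine hp ⟨i, j, hij, by simp, by simp [hj], hr.mono (edgesWithin_mono G fun k hk => ?_)⟩
    simp only [indexSet, Set.mem_ofPred_eq, Finset.mem_union, Finset.mem_insert,
      Finset.mem_singleton, xVar_inj, yVar_ne_xVar, false_or] at hk ⊢
    rcases hk with ((h | rfl) | h) | h
    · exact Or.inl (Or.inl h)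
    · exact Or.inr hb
    · exact Or.inl (Or.inr h)
    · exact Or.inr h
  · exact absurd (hmax j hj) hij.not_ge
  · exact absurd (hF i j hi hj) hij.not_gt

theorem not_hasCrossing_insert_yVar (hF : ∀ i j, xVar i ∈ F → yVar j ∈ F → j < i)
    {q a : Fin n} (ha : xVar a ∈ F) (hmin : ∀ i, xVar i ∈ F → a ≤ i)
    (hq : ¬ HasCrossing G ({yVar q} ∪ F)) : ¬ HasCrossing G ({yVar q, yVar a} ∪ F) := by
  rintro ⟨i, j, hij, hi, hj, hr⟩
  replace hi : xVar i ∈ F := by simpa using hi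
  simp only [Finset.mem_union, Finset.mem_insert, Finset.mem_singleton, yVar_inj] at hj
  rcases hj with (rfl | rfl) | hj
  · refine hq ⟨i, j, hij, by simp [hi], by simp, hr.mono (edgesWithin_mono G fun k hk => ?_)⟩
    simp only [indexSet, Set.mem_ofPred_eq, Finset.mem_union, Finset.mem_insert,
      Finset.mem_singleton, yVar_inj, xVar_ne_yVar, false_or] at hk ⊢
    rcases hk with h | (h | rfl) | h
    · exact Or.inl h
    · exact Or.inr (Or.inl h)
    · exact Or.inl ha
    · exact Or.inr (Or.inr h)
  · exact absurd (hmin i hi) hij.not_ge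
  · exact absurd (hF i j hi hj) hij.not_gt

variable {K : Type*} [Field K]

theorem mem_link_edgeComplex_faces {H : Finset (EdgeVar n)} :
    H ∈ ((edgeComplex K G).link F).faces ↔ Disjoint H F ∧ ¬ HasCrossing G (H ∪ F) :=
  and_congr_right fun _ => mem_edgeComplex_faces

theorem disjoint_pair {a b : EdgeVar n} (ha : a ∉ F) (hb : b ∉ F) : Disjoint {a, b} F := by
  simp [ha, hb]

/-- Two vertices of the link are joined by edges of the link. -/
def JoinedInLink (K : Type*) [Field K] (G : SimpleGraph (Fin n)) (F : Finset (EdgeVar n)) :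
    EdgeVar n → EdgeVar n → Prop :=
  Relation.ReflTransGen fun a b => {a, b} ∈ ((edgeComplex K G).link F).faces

theorem JoinedInLink.symm {a b : EdgeVar n} (h : JoinedInLink K G F a b) :
    JoinedInLink K G F b a :=
  have : Std.Symm fun a b : EdgeVar n => {a, b} ∈ ((edgeComplex K G).link F).faces :=
    ⟨fun a b hab => by rwa [Finset.pair_comm]⟩
  Std.Symm.symm (r := Relation.ReflTransGen _) _ _ h

theorem joinedInLink_xVar (hF : ∀ i j, xVar i ∈ F → yVar j ∈ F → j < i) {p p' : Fin n}
    (hp : {xVar p} ∈ ((edgeComplex K G).link F).faces)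
    (hp' : {xVar p'} ∈ ((edgeComplex K G).link F).faces) :
    JoinedInLink K G F (xVar p) (xVar p') := by
  rw [mem_link_edgeComplex_faces, Finset.disjoint_singleton_left] at hp hp'
  by_cases h : ∃ j, yVar j ∈ F
  · obtain ⟨b, hb, hmax⟩ := exists_max_yVar h
    have hbF : xVar b ∉ F := fun h => (hF b b h hb).false
    have key : ∀ r, xVar r ∉ F ∧ ¬ HasCrossing G ({xVar r} ∪ F) →
        JoinedInLink K G F (xVar r) (xVar b) := fun r hr =>
      Relation.ReflTransGen.single (mem_link_edgeComplex_faces.2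
        ⟨disjoint_pair hr.1 hbF, not_hasCrossing_insert_xVar hF hb hmax hr.2⟩)
    exact (key p hp).trans (key p' hp').symm
  · refine Relation.ReflTransGen.single (mem_link_edgeComplex_faces.2
      ⟨disjoint_pair hp.1 hp'.1, ?_⟩)
    rintro ⟨i, j, -, -, hj, -⟩
    exact h ⟨j, by simpa using hj⟩

theorem joinedInLink_yVar (hF : ∀ i j, xVar i ∈ F → yVar j ∈ F → j < i) {q q' : Fin n}
    (hq : {yVar q} ∈ ((edgeComplex K G).link F).faces)
    (hq' : {yVar q'} ∈ ((edgeComplex K G).link F).faces) :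
    JoinedInLink K G F (yVar q) (yVar q') := by
  rw [mem_link_edgeComplex_faces, Finset.disjoint_singleton_left] at hq hq'
  by_cases h : ∃ i, xVar i ∈ F
  · obtain ⟨a, ha, hmin⟩ := exists_min_xVar h
    have haF : yVar a ∉ F := fun h => (hF a a ha h).false
    have key : ∀ r, yVar r ∉ F ∧ ¬ HasCrossing G ({yVar r} ∪ F) →
        JoinedInLink K G F (yVar r) (yVar a) := fun r hr =>
      Relation.ReflTransGen.single (mem_link_edgeComplex_faces.2
        ⟨disjoint_pair hr.1 haF, not_hasCrossing_insert_yVar hF ha hmin hr.2⟩)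
    exact (key q hq).trans (key q' hq').symm
  · refine Relation.ReflTransGen.single (mem_link_edgeComplex_faces.2
      ⟨disjoint_pair hq.1 hq'.1, ?_⟩)
    rintro ⟨i, j, -, hi, -, -⟩
    exact h ⟨i, by simpa using hi⟩

theorem exists_xVar_yVar_mem_link (hF : ∀ i j, xVar i ∈ F → yVar j ∈ F → j < i)
    (hcard : F.card < n) :
    ∃ u v : Fin n, {xVar u, yVar v} ∈ ((edgeComplex K G).link F).faces := by
  -- If all `x`-indices are at least `c` and all `y`-indices at most `c`, no crossing is possible,
  -- whatever `G` is. The cut `c` is chosen below according to the position of the free index `m`.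
  have key : ∀ c u v : Fin n, c ≤ u → v ≤ c → xVar u ∉ F → yVar v ∉ F →
      (∀ i, xVar i ∈ F → c ≤ i) → (∀ j, yVar j ∈ F → j ≤ c) →
      ∃ u v : Fin n, {xVar u, yVar v} ∈ ((edgeComplex K G).link F).faces := by
    intro c u v hu hv huF hvF hx hy
    refine ⟨u, v, mem_link_edgeComplex_faces.2
      ⟨disjoint_pair huF hvF, not_hasCrossing_of_cut G c (fun i hi => ?_) fun j hj => ?_⟩⟩
    · simp only [Finset.mem_union, Finset.mem_insert, Finset.mem_singleton, xVar_inj,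
        xVar_ne_yVar, or_false] at hi
      rcases hi with rfl | hi
      · exact hu
      · exact hx i hi
    · simp only [Finset.mem_union, Finset.mem_insert, Finset.mem_singleton, yVar_inj,
        yVar_ne_xVar, false_or] at hj
      rcases hj with rfl | hj
      · exact hv
      · exact hy j hj
  obtain ⟨m, hmx, hmy⟩ := exists_index_notMem hcard
  by_cases hy : ∃ j, yVar j ∈ F ∧ m < j
  · obtain ⟨j, hj, hmj⟩ := hy
    obtain ⟨b, hb, hmax⟩ := exists_max_yVar ⟨j, hj⟩
    exact key b b m le_rfl (hmj.le.trans (hmax j hj)) (fun h => (hF b b h hb).false) hmy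
      (fun i hi => (hF i b hi hb).le) hmax
  by_cases hx : ∃ i, xVar i ∈ F ∧ i < m
  · obtain ⟨i, hi, him⟩ := hx
    obtain ⟨a, ha, hmin⟩ := exists_min_xVar ⟨i, hi⟩
    exact key a m a ((hmin i hi).trans him.le) le_rfl hmx (fun h => (hF a a ha h).false)
      hmin (fun j hj => (hF a j ha hj).le)
  push Not at hx hy
  exact key m m m le_rfl le_rfl hmx hmy hx hy

theorem isConnected_link_edgeComplex (hF : ∀ i j, xVar i ∈ F → yVar j ∈ F → j < i)
    (hcard : F.card < n) : ((edgeComplex K G).link F).IsConnected := by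
  have hxy : ∀ p q, {xVar p} ∈ ((edgeComplex K G).link F).faces →
      {yVar q} ∈ ((edgeComplex K G).link F).faces → JoinedInLink K G F (xVar p) (yVar q) := by
    intro p q hp hq
    obtain ⟨u, v, huv⟩ := exists_xVar_yVar_mem_link (K := K) (G := G) hF hcard
    have hu := SimpComplex.down_closed _ _ huv {xVar u} (by simp)
    have hv := SimpComplex.down_closed _ _ huv {yVar v} (by simp)
    exact ((joinedInLink_xVar hF hp hu).tail huv).trans (joinedInLink_yVar hF hv hq)
  refine SimpComplex.isConnected_of_vertices (V := Lex (Fin n ⊕ Fin n)) _ fun z w hz hw => ?_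
  obtain ⟨p, rfl⟩ | ⟨p, rfl⟩ := edgeVar_cases z <;> obtain ⟨q, rfl⟩ | ⟨q, rfl⟩ := edgeVar_cases w
  · exact joinedInLink_xVar hF hz hw
  · exact hxy p q hz hw
  · exact (hxy q p hw hz).symm
  · exact joinedInLink_yVar hF hz hw

end Link

theorem mainTheorem8 (K : Type*) [Field K] (n : ℕ) (G : SimpleGraph (Fin n))
    (hG : IsUnmixedIdeal (binomialEdgeIdeal K G)) :
    stanleyReisnerIdeal K (edgeComplex K G) =
      initialIdeal MonomialOrder.lex (binomialEdgeIdeal K G) ∧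
    ∀ F ∈ (edgeComplex K G).faces,
      (∀ i j : Fin n, xVar i ∈ F → yVar j ∈ F → j < i) →
      faceDim F ≤ (n : ℤ) - 2 →
      ((edgeComplex K G).link F).IsConnected := by
  refine ⟨stanleyReisnerIdeal_edgeComplex K G, fun F _ hF hdim => ?_⟩
  refine isConnected_link_edgeComplex hF ?_
  simp only [faceDim] at hdim
  omega
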